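/- Let $n,n_d\ge 0$ be integers, let $h\ge 0$, and let $A_0,A_1\in\mathbb R^{n\times n}$, $C_d\in\mathbb R^{n\times n_d}$, $A_d\in\mathbb R^{n_d\times n_d}$, $B_d\in\mathbb R^{n_d\times n}$. Put $A_D(\theta)=C_d e^{A_d\theta}B_d$, and let \[\Lambda=\Big\{\lambda\in\mathbb C:\ \det\Big(\lambda I-A_0-e^{-\lambda h}A_1-\int_{-h}^0 e^{\lambda\theta}A_D(\theta)\,d\theta\Big)=0\Big\}\] be the spectrum of the time-delay system $\dot x(t)=A_0x(t)+A_1x(t-h)+\int_{-h}^0A_D(\theta)x(t+\theta)\,d\theta$. For a symmetric matrix $Q\in\mathbb R^{n\times n}$, a solution of the delay Lyapunov equation (DDEc) is a function $P:[-h,h]\to\mathbb R^{n\times n}$ such that for all $\tau\in[0,h]$ (with one-sided derivatives at the endpoints of $[0,h]$; for $h=0$ the first equation is void) \[\dot P(\tau)=P(\tau)A_0+P(\tau-h)A_1+\int_{-h}^0P(\tau+\theta)A_D(\theta)\,d\theta,\qquad P(-\tau)=P(\tau)^{\intercal},\] and \[-Q=A_0^{\intercal}P(0)+P(0)A_0+A_1^{\intercal}P(h)+P(-h)A_1+\int_{-h}^0\big[A_D(\theta)^{\intercal}P(-\theta)+P(\theta)A_D(\theta)\big]\,d\theta.\]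 Then for every symmetric $Q\in\mathbb R^{n\times n}$, the DDEc has a unique solution on $[-h,h]$ if and only if the spectrum condition holds: for every $\lambda\in\Lambda$, $-\lambda\notin\Lambda$. -/

import Mathlib

namespace DelayLyapunov

/-- The data of the linear time-delay system
`x'(t) = A₀ x(t) + A₁ x(t - h) + ∫_{-h}^0 A_D(θ) x(t + θ) dθ`, with `A_D(θ) = C_d e^{A_d θ} B_d`. -/
structure DelaySystem (n m : ℕ) where
  A₀ : Matrix (Fin n) (Fin n) ℝ
  A₁ : Matrix (Fin n) (Fin n) ℝ
  Cd : Matrix (Fin n) (Fin m) ℝ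
  Ad : Matrix (Fin m) (Fin m) ℝ
  Bd : Matrix (Fin m) (Fin n) ℝ
  h : ℝ
  h_nonneg : 0 ≤ h

/-- The entrywise integral `∫_a^b F(θ) dθ` of a matrix-valued function. -/
noncomputable def matrixIntegral {n : ℕ} {E : Type*} [NormedAddCommGroup E] [NormedSpace ℝ E]
    (a b : ℝ) (F : ℝ → Matrix (Fin n) (Fin n) E) : Matrix (Fin n) (Fin n) E :=
  Matrix.of fun i j => ∫ θ in a..b, F θ i j

namespace DelaySystem

variable {n m : ℕ} (S : DelaySystem n m)

/-- The kernel `A_D(θ) = C_d e^{A_d θ} B_d` of the distributed delay. -/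
noncomputable def AD (θ : ℝ) : Matrix (Fin n) (Fin n) ℝ :=
  S.Cd * NormedSpace.exp (θ • S.Ad) * S.Bd

/-- `P` solves the delay Lyapunov equation for the matrix `Q`. Only the values of `P` on `[-h, h]`
matter; derivatives at the endpoints of `[0, h]` are one-sided. -/
structure IsSolution (Q : Matrix (Fin n) (Fin n) ℝ) (P : ℝ → Matrix (Fin n) (Fin n) ℝ) :
    Prop where
  dynamic : ∀ τ ∈ Set.Icc 0 S.h, HasDerivWithinAt P
    (P τ * S.A₀ + P (τ - S.h) * S.A₁ + matrixIntegral (-S.h) 0 fun θ => P (τ + θ) * S.AD θ)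
    (Set.Icc 0 S.h) τ
  symmetric : ∀ τ ∈ Set.Icc 0 S.h, P (-τ) = (P τ).transpose
  algebraic : -Q = S.A₀.transpose * P 0 + P 0 * S.A₀ + S.A₁.transpose * P S.h + P (-S.h) * S.A₁
    + matrixIntegral (-S.h) 0 fun θ => (S.AD θ).transpose * P (-θ) + P θ * S.AD θ

/-- The delay Lyapunov equation for `Q` has exactly one solution on `[-h, h]`. -/
def HasUniqueSolution (Q : Matrix (Fin n) (Fin n) ℝ) : Prop :=
  (∃ P, S.IsSolution Q P) ∧
    ∀ P₁ P₂, S.IsSolution Q P₁ → S.IsSolution Q P₂ → Set.EqOn P₁ P₂ (Set.Icc (-S.h) S.h)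

/-- The characteristic matrix
`λ I - A₀ - e^{-λ h} A₁ - ∫_{-h}^0 e^{λ θ} A_D(θ) dθ`. -/
noncomputable def charMatrix (l : ℂ) : Matrix (Fin n) (Fin n) ℂ :=
  l • (1 : Matrix (Fin n) (Fin n) ℂ) - S.A₀.map Complex.ofReal
    - Complex.exp (-l * (S.h : ℂ)) • S.A₁.map Complex.ofReal
    - matrixIntegral (-S.h) 0 fun θ => Complex.exp (l * (θ : ℂ)) • (S.AD θ).map Complex.ofReal

/-- The spectrum of the time-delay system: the set of its characteristic roots. -/
def charRoots : Set ℂ := {l | (S.charMatrix l).det = 0}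

/-- The spectrum condition. -/
def SpectrumCondition : Prop := ∀ l ∈ S.charRoots, -l ∉ S.charRoots

end DelaySystem

end DelayLyapunov

/-!
The delay Lyapunov equation only involves right multiplication by `A₀`, `A₁`, `A_D(θ)` and left
multiplication by their transposes, and these two families commute. Write
`(L f)(t) = f(t) A₀ + f(t - h) A₁ + ∫_{-h}^0 f(t + θ) A_D(θ) dθ` and let `R` be the mirror image of
`L` under `f(t) ↦ f(-t)ᵀ`. Complexified, and with the symmetry `P(-t) = P(t)ᵀ` used to describe `P`
on `[-h, 0]`, the equation says that `f' = L f` on `[0, h]`, that `f' = -R f` on `[-h, 0]`, and that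
`L f(0) + R f(0) = -Q`; this is `DelayKernel.IsTwoSidedSolution`.

These three conditions together are the single fixed point equation `f = T f + Q` in the space of
continuous functions on `[-h, h]`, where `T` is `DelayKernel.integralOp`. By Arzelà–Ascoli `T` is
compact (`isCompactOperator_integralOp`), so by the Fredholm alternative solutions exist for every
`Q` as soon as `T f = f` forces `f = 0` (`exists_isTwoSidedSolution`); averaging a solution with its
mirror image makes it symmetric.

The fixed points of `T` form a finite-dimensional space. Because `L` and `R` commute, this space is
stable under differentiation, that is, under `f ↦ L f` on `[0, h]`, `-R f` on `[-h, 0]`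
(`IsTwoSidedSolution.derivative`). If it is nonzero, differentiation has an eigenvector in it, which
is of the form `e^{lt} N` (`exists_exp_solution`). Then `N Δ(l) = 0` and `Δ(-l)ᵀ N = 0` for the
characteristic matrix `Δ`, so both `l` and `-l` are characteristic roots. Conversely, if
`v Δ(l) = 0` and `u Δ(-l) = 0` with `u, v ≠ 0`, then `e^{lt} u vᵀ + e^{-lt} v uᵀ` is a symmetric
homogeneous solution that does not vanish at `0`, and its real or imaginary part destroys
uniqueness. The case `h = 0` needs no separate treatment.
-/

namespace DelayLyapunov

open Set MeasureTheory
open scoped BoundedContinuousFunction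

/-! ### Retarded operators -/

/-- The coefficients of a linear delay operator on `E`-valued functions: one for the present value,
one for the value delayed by `h`, and a density for the distributed delay over `[-h, 0]`. The delay
`h` is not part of the data. -/
structure DelayKernel (E : Type*) [NormedAddCommGroup E] [NormedSpace ℂ E] where
  present : E →L[ℂ] E
  delayed : E →L[ℂ] E
  density : ℝ → E →L[ℂ] E
  continuous_density : Continuous density

namespace DelayKernel

variable {E : Type*} [NormedAddCommGroup E] [NormedSpace ℂ E]

/-- The set of all operators that occur as coefficients of the kernel. -/
def coeffs (a : DelayKernel E) : Set (E →L[ℂ] E) :=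
  {a.present, a.delayed} ∪ range a.density

/-- The delay operator `f(t) ↦ a₀ f(t) + a₁ f(t - h) + ∫_{-h}^0 a(θ) f(t + θ) dθ`. The function `f`
lives on all of `ℝ`, but only its values on `[t - h, t]` matter (`retarded_congr`). -/
noncomputable def retarded (a : DelayKernel E) (h : ℝ) (f : ℝ → E) (t : ℝ) : E :=
  a.present (f t) + a.delayed (f (t - h)) + ∫ θ in (-h)..0, a.density θ (f (t + θ))

variable (a b : DelayKernel E) {h : ℝ} {f g : ℝ → E}

lemma continuous_density_apply (hf : Continuous f) :
    Continuous fun p : ℝ × ℝ => a.density p.2 (f (p.1 + p.2)) :=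
  (a.continuous_density.comp continuous_snd).clm_apply (by fun_prop)

lemma intervalIntegrable_density (hf : Continuous f) (t x y : ℝ) :
    IntervalIntegrable (fun θ => a.density θ (f (t + θ))) volume x y :=
  (a.continuous_density.clm_apply (by fun_prop)).intervalIntegrable x y

lemma continuous_retarded (hf : Continuous f) : Continuous (a.retarded h f) := by
  have h1 : Continuous fun t => ∫ θ in (-h)..0, a.density θ (f (t + θ)) :=
    intervalIntegral.continuous_parametric_intervalIntegral_of_continuous'
      (f := fun t θ => a.density θ (f (t + θ))) (a.continuous_density_apply hf) (-h) 0
  unfold retarded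
  fun_prop

lemma retarded_congr (hh : 0 ≤ h) {t : ℝ} (hfg : EqOn f g (Icc (t - h) t)) :
    a.retarded h f t = a.retarded h g t := by
  unfold retarded
  rw [hfg ⟨by linarith, le_rfl⟩, hfg ⟨le_rfl, by linarith⟩]
  congr 1
  refine intervalIntegral.integral_congr fun θ hθ => ?_
  rw [uIcc_of_le (by linarith)] at hθ
  rw [hfg ⟨by linarith [hθ.1], by linarith [hθ.2]⟩]

lemma retarded_add (hf : Continuous f) (hg : Continuous g) (t : ℝ) :
    a.retarded h (fun s => f s + g s) t = a.retarded h f t + a.retarded h g t := by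
  simp only [retarded, map_add]
  rw [intervalIntegral.integral_add (a.intervalIntegrable_density hf _ _ _)
    (a.intervalIntegrable_density hg _ _ _)]
  abel

lemma retarded_smul (c : ℂ) (f : ℝ → E) (t : ℝ) :
    a.retarded h (fun s => c • f s) t = c • a.retarded h f t := by
  simp only [retarded, map_smul, intervalIntegral.integral_smul, smul_add]

lemma retarded_neg (f : ℝ → E) (t : ℝ) :
    a.retarded h (fun s => -f s) t = -a.retarded h f t := by
  simpa using a.retarded_smul (h := h) (-1) f t

lemma exists_norm_retarded_le (hh : 0 ≤ h) :
    ∃ C, 0 ≤ C ∧ ∀ f : ℝ → E, (∀ t, ‖f t‖ ≤ 1) → ∀ t, ‖a.retarded h f t‖ ≤ C := by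
  obtain ⟨K, hK⟩ := isCompact_Icc.exists_bound_of_continuousOn
    (s := Icc (-h) 0) a.continuous_density.continuousOn
  have hK0 : 0 ≤ K := (norm_nonneg _).trans (hK 0 ⟨by linarith, le_rfl⟩)
  refine ⟨‖a.present‖ + ‖a.delayed‖ + K * h, by positivity, fun f hf t => ?_⟩
  refine (norm_add₃_le).trans (add_le_add_three (a.present.unit_le_opNorm _ (hf _))
    (a.delayed.unit_le_opNorm _ (hf _)) ?_)
  have := intervalIntegral.norm_integral_le_of_norm_le_const (a := -h) (b := 0) (C := K)
    (f := fun θ => a.density θ (f (t + θ))) fun θ hθ => by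
      rw [uIoc_of_le (by linarith)] at hθ
      exact ((a.density θ).unit_le_opNorm _ (hf _)).trans (hK θ ⟨hθ.1.le, hθ.2⟩)
  simpa [abs_of_nonneg hh] using this

/-- Exponential functions are mapped to exponential functions, by translation invariance. -/
lemma retarded_exp_smul (l : ℂ) (N : E) (t : ℝ) :
    a.retarded h (fun s => Complex.exp (l * s) • N) t =
      Complex.exp (l * t) • a.retarded h (fun s => Complex.exp (l * s) • N) 0 := by
  rw [← retarded_smul]
  simp only [retarded, smul_smul, ← Complex.exp_add]
  push_cast
  simp only [mul_zero, zero_add, add_zero, mul_add, mul_neg, sub_eq_add_neg]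

lemma retarded_comp_sub (f : ℝ → E) (c t : ℝ) :
    a.retarded h (fun s => f (s - c)) t = a.retarded h f (t - c) := by
  simp only [retarded, sub_right_comm, sub_add_eq_add_sub]

variable [CompleteSpace E]

lemma retarded_clm_comp {B : E →L[ℂ] E} (hB : ∀ A ∈ a.coeffs, Commute A B)
    (hf : Continuous f) (t : ℝ) :
    a.retarded h (fun s => B (f s)) t = B (a.retarded h f t) := by
  have comm : ∀ A ∈ a.coeffs, ∀ x, A (B x) = B (A x) := fun A hA x =>
    congrArg (fun T : E →L[ℂ] E => T x) (hB A hA)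
  have h1 : ∀ θ x, a.density θ (B x) = B (a.density θ x) := fun θ => comm _ (by simp [coeffs])
  simp only [retarded, map_add, comm a.present (by simp [coeffs]),
    comm a.delayed (by simp [coeffs]), h1]
  rw [ContinuousLinearMap.intervalIntegral_comp_comm _ (a.intervalIntegrable_density hf _ _ _)]

/-- Fubini: the delay operator may be applied under an integral sign. -/
lemma retarded_integral {F : ℝ → ℝ → E} (hF : Continuous fun p : ℝ × ℝ => F p.1 p.2)
    (x y t : ℝ) :
    a.retarded h (fun s => ∫ φ in x..y, F φ s) t = ∫ φ in x..y, a.retarded h (F φ) t := by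
  have hF' : ∀ s, Continuous fun φ => F φ s := fun s => by fun_prop
  have hc : Continuous fun p : ℝ × ℝ => a.density p.2 (F p.1 (t + p.2)) :=
    (a.continuous_density.comp continuous_snd).clm_apply
      (hF.comp (continuous_fst.prodMk (continuous_const.add continuous_snd)))
  have h3 : Continuous fun φ => ∫ θ in (-h)..0, a.density θ (F φ (t + θ)) :=
    intervalIntegral.continuous_parametric_intervalIntegral_of_continuous'
      (f := fun φ θ => a.density θ (F φ (t + θ))) hc (-h) 0
  unfold retarded
  rw [intervalIntegral.integral_add
      (Continuous.intervalIntegrable (by fun_prop) _ _) (h3.intervalIntegrable _ _),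
    intervalIntegral.integral_add
      (Continuous.intervalIntegrable (by fun_prop) _ _)
      (Continuous.intervalIntegrable (by fun_prop) _ _),
    intervalIntegral_intervalIntegral_swap,
    ContinuousLinearMap.intervalIntegral_comp_comm _ ((hF' _).intervalIntegrable _ _),
    ContinuousLinearMap.intervalIntegral_comp_comm _ ((hF' _).intervalIntegrable _ _)]
  · congr 1
    refine intervalIntegral.integral_congr fun θ _ => ?_
    exact (ContinuousLinearMap.intervalIntegral_comp_comm _
      ((hF' _).intervalIntegrable _ _)).symm
  · exact (hc.continuousOn.integrableOn_compact (isCompact_uIcc.prod isCompact_uIcc)).mono_set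
      (prod_mono uIoc_subset_uIcc uIoc_subset_uIcc)

/-- The delay operator commutes with differentiation, in integrated form: if `g` is the derivative
of `f` on `[-h, h]`, then `retarded g` is the derivative of `retarded f` on `[0, h]`. -/
lemma retarded_sub_retarded_zero (hh : 0 ≤ h) (hg : Continuous g) (hf : Continuous f)
    (hfg : ∀ x ∈ Icc (-h) h, ∀ y ∈ Icc (-h) h, f y - f x = ∫ s in x..y, g s)
    {t : ℝ} (ht : t ∈ Icc 0 h) :
    a.retarded h f t - a.retarded h f 0 = ∫ s in (0 : ℝ)..t, a.retarded h g s := by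
  obtain ⟨ht0, hth⟩ := ht
  calc a.retarded h f t - a.retarded h f 0
      = a.retarded h (fun x => f (x - -t) + -f x) 0 := by
        rw [retarded_add _ (by fun_prop) (by fun_prop), retarded_neg, retarded_comp_sub]
        simp [sub_eq_add_neg]
    _ = a.retarded h (fun x => ∫ s in (0 : ℝ)..t, g (x - -s)) 0 := by
        refine a.retarded_congr hh fun x hx => ?_
        simp only [zero_sub] at hx
        simp only [sub_neg_eq_add, ← sub_eq_add_neg]
        rw [hfg _ ⟨by linarith [hx.1], by linarith [hx.2]⟩ _
          ⟨by linarith [hx.1], by linarith [hx.2]⟩, intervalIntegral.integral_comp_add_left,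
          add_zero]
    _ = ∫ s in (0 : ℝ)..t, a.retarded h g s := by
        rw [a.retarded_integral (F := fun s x => g (x - -s)) (by fun_prop)]
        refine intervalIntegral.integral_congr fun s _ => ?_
        simpa using a.retarded_comp_sub (h := h) g (-s) 0

/-- If the coefficients of `a` and `b` commute, then so do the retarded operator of `a` and the
advanced operator `f ↦ (x ↦ b.retarded h (fun s ↦ f (-s)) (-x))` of `b`; this is the equality of
their two composites on `f` at the point `0`. -/
lemma retarded_retarded_neg_comm (hab : ∀ A ∈ a.coeffs, ∀ B ∈ b.coeffs, Commute A B)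
    (hf : Continuous f) :
    a.retarded h (fun x => b.retarded h (fun s => f (-s)) (-x)) 0 =
      b.retarded h (fun x => a.retarded h f (-x)) 0 := by
  have hc : Continuous fun p : ℝ × ℝ => b.density p.1 (f (p.2 - p.1)) :=
    (b.continuous_density.comp continuous_fst).clm_apply (by fun_prop)
  have hi : Continuous fun x => ∫ φ in (-h)..0, b.density φ (f (x - φ)) :=
    intervalIntegral.continuous_parametric_intervalIntegral_of_continuous'
      (f := fun x φ => b.density φ (f (x - φ))) (hc.comp continuous_swap) (-h) 0
  have e : (fun x => b.retarded h (fun s => f (-s)) (-x)) = fun x =>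
      b.present (f x) + b.delayed (f (x - -h)) + ∫ φ in (-h)..0, b.density φ (f (x - φ)) := by
    funext x
    simp only [retarded, neg_add, neg_sub, neg_neg, sub_neg_eq_add, ← sub_eq_add_neg, add_comm h]
  rw [e, a.retarded_add (f := fun x => b.present (f x) + b.delayed (f (x - -h)))
      (by fun_prop) hi, a.retarded_add (by fun_prop) (by fun_prop),
    a.retarded_clm_comp (fun A hA => hab A hA _ (by simp [coeffs])) hf,
    a.retarded_clm_comp (f := fun x => f (x - -h))
      (fun A hA => hab A hA _ (by simp [coeffs])) (by fun_prop),
    a.retarded_integral (F := fun φ x => b.density φ (f (x - φ))) hc, retarded_comp_sub]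
  have e2 : ∀ φ, a.retarded h (fun x => b.density φ (f (x - φ))) 0
      = b.density φ (a.retarded h f (-φ)) := fun φ => by
    rw [a.retarded_clm_comp (f := fun x => f (x - φ))
      (fun A hA => hab A hA _ (by simp [coeffs])) (by fun_prop), retarded_comp_sub, zero_sub]
  simp only [e2]
  simp [retarded]

end DelayKernel

/-! ### Two-sided solutions of the coupled equations -/

namespace DelayKernel

variable {E : Type*} [NormedAddCommGroup E] [NormedSpace ℂ E]
  (a b : DelayKernel E) {h : ℝ} {f g : ℝ → E} {q : E}

/-- `f` satisfies `f' = L f` on `[0, h]` and `f' = -R f` on `[-h, 0]`, both in integrated form, and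
`L f(0) + R f(0) = -q`, so that `-q` is the jump of `f'` at `0`. Here `L = a.retarded h`, and
`R f(t) = b.retarded h (fun s ↦ f (-s)) (-t)` is the advanced operator with the coefficients of
`b`. -/
structure IsTwoSidedSolution (h : ℝ) (q : E) (f : ℝ → E) : Prop where
  jump : a.retarded h f 0 + b.retarded h (fun s => f (-s)) 0 = -q
  forward : ∀ t ∈ Icc 0 h, f t = f 0 + ∫ s in (0 : ℝ)..t, a.retarded h f s
  backward : ∀ t ∈ Icc 0 h,
    f (-t) = f 0 + ∫ s in (0 : ℝ)..t, b.retarded h (fun s => f (-s)) s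

variable {a b}

lemma exp_smul_sub (l : ℂ) (N : E) [CompleteSpace E] (t : ℝ) :
    Complex.exp (l * t) • N = N + ∫ s in (0 : ℝ)..t, Complex.exp (l * s) • (l • N) := by
  have hd : ∀ s : ℝ, HasDerivAt (fun s : ℝ => Complex.exp (l * s) • N)
      (Complex.exp (l * s) • (l • N)) s := fun s => by
    have h1 : HasDerivAt (fun s : ℝ => Complex.exp (l * s)) (Complex.exp (l * s) * l) s := by
      simpa using ((Complex.ofRealCLM.hasDerivAt (x := s)).const_mul l).cexp
    rw [smul_smul]
    exact h1.smul_const N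
  rw [intervalIntegral.integral_eq_sub_of_hasDerivAt (fun s _ => hd s)
    (Continuous.intervalIntegrable (by fun_prop) _ _)]
  simp

lemma isTwoSidedSolution_exp [CompleteSpace E] {l : ℂ} {N : E}
    (ha : a.retarded h (fun s => Complex.exp (l * s) • N) 0 = l • N)
    (hb : b.retarded h (fun s => Complex.exp (-l * s) • N) 0 = -l • N) :
    IsTwoSidedSolution a b h 0 fun s => Complex.exp (l * s) • N := by
  have e : (fun s : ℝ => Complex.exp (l * ((-s : ℝ) : ℂ)) • N)
      = fun s : ℝ => Complex.exp (-l * s) • N := by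
    funext s; simp
  refine ⟨?_, fun t _ => ?_, fun t _ => ?_⟩
  · rw [e, ha, hb]; simp
  · rw [show a.retarded h (fun s => Complex.exp (l * s) • N)
      = fun t : ℝ => Complex.exp (l * t) • (l • N) from
        funext fun t => by rw [a.retarded_exp_smul, ha]]
    simpa only [Complex.ofReal_zero, mul_zero, Complex.exp_zero, one_smul]
      using exp_smul_sub l N t
  · rw [e, show b.retarded h (fun s => Complex.exp (-l * s) • N)
      = fun t : ℝ => Complex.exp (-l * t) • (-l • N) from
        funext fun t => by rw [b.retarded_exp_smul, hb]]
    simpa only [Complex.ofReal_zero, Complex.ofReal_neg, mul_neg, neg_mul, mul_zero,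
      Complex.exp_zero, one_smul] using exp_smul_sub (-l) N t

namespace IsTwoSidedSolution

lemma congr (hh : 0 ≤ h) (hf : IsTwoSidedSolution a b h q f) (hfg : EqOn f g (Icc (-h) h)) :
    IsTwoSidedSolution a b h q g := by
  have h0 : g 0 = f 0 := (hfg ⟨by linarith, hh⟩).symm
  have ha : ∀ t ∈ Icc 0 h, a.retarded h g t = a.retarded h f t := fun t ht =>
    a.retarded_congr hh fun x hx => (hfg ⟨by linarith [hx.1, ht.1], hx.2.trans ht.2⟩).symm
  have hb : ∀ t ∈ Icc 0 h, b.retarded h (fun s => g (-s)) t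
      = b.retarded h (fun s => f (-s)) t := fun t ht =>
    b.retarded_congr hh fun x hx =>
      (hfg ⟨by linarith [hx.2, ht.2], by linarith [hx.1, ht.1]⟩).symm
  refine ⟨?_, fun t ht => ?_, fun t ht => ?_⟩
  · rw [ha 0 ⟨le_rfl, hh⟩, hb 0 ⟨le_rfl, hh⟩, hf.jump]
  · rw [h0, ← hfg ⟨by linarith [ht.1], ht.2⟩, hf.forward t ht]
    congr 1
    refine intervalIntegral.integral_congr fun s hs => ?_
    rw [uIcc_of_le ht.1] at hs
    exact (ha s ⟨hs.1, hs.2.trans ht.2⟩).symm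
  · rw [h0, ← hfg ⟨by linarith [ht.2], by linarith [ht.1]⟩, hf.backward t ht]
    congr 1
    refine intervalIntegral.integral_congr fun s hs => ?_
    rw [uIcc_of_le ht.1] at hs
    exact (hb s ⟨hs.1, hs.2.trans ht.2⟩).symm

/-- The two one-sided equations say that `f` is a primitive of the function `g` that equals `L f` on
`[0, h]` and `-R f` on `[-h, 0]`. -/
lemma eq_add_integral (hf : IsTwoSidedSolution a b h q f)
    (hg₁ : ∀ t ∈ Icc 0 h, g t = a.retarded h f t)
    (hg₂ : ∀ t ∈ Icc 0 h, g (-t) = -b.retarded h (fun s => f (-s)) t)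
    {t : ℝ} (ht : t ∈ Icc (-h) h) : f t = f 0 + ∫ s in (0 : ℝ)..t, g s := by
  rcases le_total 0 t with h0 | h0
  · rw [hf.forward t ⟨h0, ht.2⟩]
    congr 1
    refine intervalIntegral.integral_congr fun s hs => ?_
    rw [uIcc_of_le h0] at hs
    exact (hg₁ s ⟨hs.1, hs.2.trans ht.2⟩).symm
  · have := hf.backward (-t) ⟨by linarith, by linarith [ht.1]⟩
    rw [neg_neg] at this
    rw [this]
    congr 1
    have e : ∫ s in (0 : ℝ)..(-t), b.retarded h (fun s => f (-s)) s
        = ∫ s in (0 : ℝ)..(-t), -g (-s) := by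
      refine intervalIntegral.integral_congr fun s hs => ?_
      rw [uIcc_of_le (by linarith)] at hs
      rw [hg₂ s ⟨hs.1, by linarith [hs.2, ht.1]⟩, neg_neg]
    rw [e, intervalIntegral.integral_neg, intervalIntegral.integral_comp_neg, neg_neg, neg_zero,
      ← intervalIntegral.integral_symm]

/-- The derivative of a homogeneous two-sided solution is again one. Equality of its one-sided
derivatives at `0` is where the commutation of the coefficients enters. -/
lemma derivative [CompleteSpace E] (hh : 0 ≤ h)
    (hab : ∀ A ∈ a.coeffs, ∀ B ∈ b.coeffs, Commute A B)
    (hf : IsTwoSidedSolution a b h 0 f) (hfc : Continuous f) (hgc : Continuous g)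
    (hg₁ : ∀ t ∈ Icc 0 h, g t = a.retarded h f t)
    (hg₂ : ∀ t ∈ Icc 0 h, g (-t) = -b.retarded h (fun s => f (-s)) t) :
    IsTwoSidedSolution a b h 0 g := by
  have hfg : ∀ x ∈ Icc (-h) h, ∀ y ∈ Icc (-h) h, f y - f x = ∫ s in x..y, g s := by
    intro x hx y hy
    rw [hf.eq_add_integral hg₁ hg₂ hx, hf.eq_add_integral hg₁ hg₂ hy, add_sub_add_left_eq_sub,
      intervalIntegral.integral_interval_sub_left (hgc.intervalIntegrable _ _)
        (hgc.intervalIntegrable _ _)]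
  have hfg' : ∀ x ∈ Icc (-h) h, ∀ y ∈ Icc (-h) h, f (-y) - f (-x) = ∫ s in x..y, -g (-s) := by
    intro x hx y hy
    rw [hfg _ ⟨by linarith [hx.2], by linarith [hx.1]⟩ _
      ⟨by linarith [hy.2], by linarith [hy.1]⟩, intervalIntegral.integral_neg,
      intervalIntegral.integral_comp_neg, intervalIntegral.integral_symm]
  have h00 : (0 : ℝ) ∈ Icc 0 h := ⟨le_rfl, hh⟩
  have hg0 : g 0 = -b.retarded h (fun s => f (-s)) 0 := by simpa using hg₂ 0 h00
  refine ⟨?_, fun t ht => ?_, fun t ht => ?_⟩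
  · have e1 : a.retarded h g 0
        = -a.retarded h (fun x => b.retarded h (fun s => f (-s)) (-x)) 0 := by
      rw [← retarded_neg]
      refine a.retarded_congr hh fun x hx => ?_
      have := hg₂ (-x) ⟨by linarith [hx.2], by linarith [hx.1]⟩
      rwa [neg_neg] at this
    have e2 : b.retarded h (fun s => g (-s)) 0 = b.retarded h (fun x => a.retarded h f (-x)) 0 :=
      b.retarded_congr hh fun x hx => hg₁ (-x) ⟨by linarith [hx.2], by linarith [hx.1]⟩
    rw [e1, e2, a.retarded_retarded_neg_comm b hab hfc]
    simp
  · rw [hg₁ t ht, hg₁ 0 h00, ← a.retarded_sub_retarded_zero hh hgc hfc hfg ht]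
    abel
  · have := b.retarded_sub_retarded_zero (f := fun s => f (-s)) (g := fun s => -g (-s)) hh
      (by fun_prop) (by fun_prop) hfg' ht
    simp only [retarded_neg, intervalIntegral.integral_neg] at this
    rw [hg₂ t ht, hg0, ← neg_eq_iff_eq_neg.mpr this]
    abel

/-- A continuous function with `f' = l f`, in integrated form, is an exponential. -/
lemma eqOn_exp [CompleteSpace E] (hfc : Continuous f)
    {l : ℂ} (hf : ∀ t ∈ Icc (-h) h, f t = f 0 + ∫ s in (0 : ℝ)..t, l • f s) :
    EqOn f (fun t => Complex.exp (l * t) • f 0) (Icc (-h) h) := by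
  intro t ht
  have hh : -h ≤ h := ht.1.trans ht.2
  have h0 : (0 : ℝ) ∈ Icc (-h) h := ⟨by linarith, by linarith⟩
  have hd : ∀ x : ℝ, HasDerivAt (fun t : ℝ => f 0 + ∫ s in (0 : ℝ)..t, l • f s) (l • f x) x :=
    fun x => (intervalIntegral.integral_hasDerivAt_right
      (Continuous.intervalIntegrable (by fun_prop) _ _)
      (Continuous.stronglyMeasurableAtFilter (by fun_prop) _ _)
      (Continuous.continuousAt (by fun_prop))).const_add _
  have he : ∀ x : ℝ, HasDerivAt (fun s : ℝ => Complex.exp (-l * s))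
      (Complex.exp (-l * x) * -l) x := fun x => by
    simpa using ((Complex.ofRealCLM.hasDerivAt (x := x)).const_mul (-l)).cexp
  -- `F` is `e^{-lt} f(t)`, written with an `f` that is differentiable at the endpoints too.
  set F : ℝ → E := fun t => Complex.exp (-l * t) • (f 0 + ∫ s in (0 : ℝ)..t, l • f s) with hF
  have hFd : ∀ x ∈ Icc (-h) h, HasDerivAt F 0 x := fun x hx => by
    have := (he x).smul (hd x)
    rw [← hf x hx, smul_smul, mul_neg, neg_smul, add_neg_cancel] at this
    exact this
  have hconst := constant_of_has_deriv_right_zero (f := F)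
    (fun x hx => (hFd x hx).continuousAt.continuousWithinAt)
    fun x hx => (hFd x ⟨hx.1, hx.2.le⟩).hasDerivWithinAt
  have := (hconst t ht).trans (hconst 0 h0).symm
  simp only [hF, ← hf t ht] at this
  simp only [Complex.ofReal_zero, mul_zero, Complex.exp_zero, one_smul,
    intervalIntegral.integral_same, add_zero] at this
  simp only
  rw [← this, smul_smul, ← Complex.exp_add]
  simp

/-- A homogeneous solution whose derivative is `l f` is an exponential. -/
lemma eigenvector [CompleteSpace E] (hh : 0 ≤ h) (hf : IsTwoSidedSolution a b h 0 f)
    (hfc : Continuous f) {l : ℂ} (hg₁ : ∀ t ∈ Icc 0 h, l • f t = a.retarded h f t)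
    (hg₂ : ∀ t ∈ Icc 0 h, l • f (-t) = -b.retarded h (fun s => f (-s)) t)
    (hf0 : ∃ t ∈ Icc (-h) h, f t ≠ 0) :
    f 0 ≠ 0 ∧ a.retarded h (fun s => Complex.exp (l * s) • f 0) 0 = l • f 0 ∧
      b.retarded h (fun s => Complex.exp (-l * s) • f 0) 0 = -l • f 0 := by
  have key := eqOn_exp (h := h) (l := l) hfc fun t ht => hf.eq_add_integral hg₁ hg₂ ht
  have h00 : (0 : ℝ) ∈ Icc 0 h := ⟨le_rfl, hh⟩
  refine ⟨fun h0 => ?_, ?_, ?_⟩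
  · obtain ⟨t, ht, hne⟩ := hf0
    exact hne (by simpa [h0] using key ht)
  · rw [hg₁ 0 h00]
    exact a.retarded_congr hh fun x hx =>
      (key ⟨by linarith [hx.1], by linarith [hx.2]⟩).symm
  · have := hg₂ 0 h00
    rw [neg_zero] at this
    rw [neg_smul, this, neg_neg]
    refine b.retarded_congr hh fun x hx => ?_
    have := key (x := -x) ⟨by linarith [hx.2], by linarith [hx.1]⟩
    simpa using this.symm

end IsTwoSidedSolution
end DelayKernel

/-! ### Compactness, the Fredholm alternative and exponential solutions -/

namespace DelayKernel

section Extend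

variable {E : Type*} [NormedAddCommGroup E] {h : ℝ} {f : ℝ → E}

/-- Extension of a function on `[-h, h]` to `ℝ` by its values at the endpoints. -/
noncomputable def extend (hh : 0 ≤ h) (f : Icc (-h) h →ᵇ E) : ℝ → E :=
  IccExtend (neg_le_self hh) f

lemma continuous_extend (hh : 0 ≤ h) (f : Icc (-h) h →ᵇ E) : Continuous (extend hh f) :=
  f.continuous.Icc_extend'

lemma extend_of_mem (hh : 0 ≤ h) (f : Icc (-h) h →ᵇ E) {t : ℝ} (ht : t ∈ Icc (-h) h) :
    extend hh f t = f ⟨t, ht⟩ := IccExtend_of_mem _ _ ht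

/-- The restriction of a continuous function to `[-h, h]`. -/
noncomputable def restrictBCF (h : ℝ) (f : ℝ → E) (hf : Continuous f) : Icc (-h) h →ᵇ E :=
  BoundedContinuousFunction.mkOfCompact ⟨fun t => f t, hf.comp continuous_subtype_val⟩

lemma norm_extend_le (hh : 0 ≤ h) (f : Icc (-h) h →ᵇ E) (t : ℝ) : ‖extend hh f t‖ ≤ ‖f‖ :=
  f.norm_coe_le_norm _

end Extend

variable {E : Type*} [NormedAddCommGroup E] [NormedSpace ℂ E]
  (a b : DelayKernel E) {h : ℝ} {f g : ℝ → E} {q : E}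

/-- The map whose affine fixed points `f = integralMap f + q` are the two-sided solutions: the
integrated equations with `L f(0) + R f(0)` added, so that evaluation at `0` gives the jump
condition. The upper limits `max t 0` and `max (-t) 0` make one of the integrals vanish. -/
noncomputable def integralMap (h : ℝ) (f : ℝ → E) (t : ℝ) : E :=
  f 0 + (a.retarded h f 0 + b.retarded h (fun s => f (-s)) 0)
    + (∫ s in (0 : ℝ)..max t 0, a.retarded h f s)
    + ∫ s in (0 : ℝ)..max (-t) 0, b.retarded h (fun s => f (-s)) s

/-- For a homogeneous solution `f`, its derivative: `L f` on `[0, h]` and `-R f` on `[-h, 0]`. The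
two branches are glued by `L f(0) = -R f(0)`, in a form that is linear and continuous for every
continuous `f`. -/
noncomputable def velocity (h : ℝ) (f : ℝ → E) (t : ℝ) : E :=
  a.retarded h f (max t 0) - b.retarded h (fun s => f (-s)) (max (-t) 0)
    + b.retarded h (fun s => f (-s)) 0

variable {a b} in
lemma isTwoSidedSolution_iff_integralMap (hh : 0 ≤ h) :
    IsTwoSidedSolution a b h q f ↔ ∀ t ∈ Icc (-h) h, f t = integralMap a b h f t + q := by
  constructor
  · intro hf t ht
    unfold integralMap
    rw [hf.jump]
    rcases le_total 0 t with h0 | h0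
    · rw [max_eq_left h0, max_eq_right (by linarith : -t ≤ 0), hf.forward t ⟨h0, ht.2⟩]
      rw [intervalIntegral.integral_same]
      abel
    · rw [max_eq_right h0, max_eq_left (by linarith : 0 ≤ -t)]
      have := hf.backward (-t) ⟨by linarith, by linarith [ht.1]⟩
      rw [neg_neg] at this
      rw [this]
      rw [intervalIntegral.integral_same]
      abel
  · intro hf
    have hj : a.retarded h f 0 + b.retarded h (fun s => f (-s)) 0 = -q := by
      have := hf 0 ⟨by linarith, hh⟩
      simp only [integralMap, neg_zero, max_self, intervalIntegral.integral_same, add_zero] at this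
      rw [add_assoc, left_eq_add] at this
      exact eq_neg_of_add_eq_zero_left this
    refine ⟨hj, fun t ht => ?_, fun t ht => ?_⟩
    · rw [hf t ⟨by linarith [ht.1], ht.2⟩, integralMap, hj, max_eq_left ht.1,
        max_eq_right (by linarith [ht.1] : -t ≤ 0)]
      rw [intervalIntegral.integral_same]
      abel
    · rw [hf (-t) ⟨by linarith [ht.2], by linarith [ht.1]⟩, integralMap, hj, neg_neg,
        max_eq_left ht.1, max_eq_right (by linarith [ht.1] : -t ≤ 0)]
      rw [intervalIntegral.integral_same]
      abel

lemma velocity_of_nonneg {t : ℝ} (ht : 0 ≤ t) : velocity a b h f t = a.retarded h f t := by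
  simp [velocity, max_eq_left ht, max_eq_right (neg_nonpos.2 ht)]

variable {a b} in
lemma IsTwoSidedSolution.velocity_neg (hf : IsTwoSidedSolution a b h 0 f) {t : ℝ} (ht : 0 ≤ t) :
    velocity a b h f (-t) = -b.retarded h (fun s => f (-s)) t := by
  have := hf.jump
  rw [neg_zero, add_eq_zero_iff_eq_neg] at this
  rw [velocity, neg_neg, max_eq_left ht, max_eq_right (neg_nonpos.2 ht), this]
  abel

lemma continuous_velocity (hf : Continuous f) : Continuous (velocity a b h f) := by
  have h1 := a.continuous_retarded (h := h) hf
  have h2 := b.continuous_retarded (h := h) (f := fun s => f (-s)) (by fun_prop)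
  unfold velocity
  fun_prop

lemma continuous_integralMap (hf : Continuous f) : Continuous (integralMap a b h f) := by
  have h1 := a.continuous_retarded (h := h) hf
  have h2 := b.continuous_retarded (h := h) (f := fun s => f (-s)) (by fun_prop)
  have i1 := intervalIntegral.continuous_primitive (μ := volume)
    (fun x y => h1.intervalIntegrable x y) 0
  have i2 := intervalIntegral.continuous_primitive (μ := volume)
    (fun x y => h2.intervalIntegrable x y) 0
  have i3 := i1.comp (continuous_id.max continuous_const : Continuous fun t : ℝ => max t 0)
  have i4 := i2.comp (continuous_neg.max continuous_const : Continuous fun t : ℝ => max (-t) 0)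
  exact (continuous_const.add i3).add i4

lemma velocity_add (hf : Continuous f) (hg : Continuous g) (t : ℝ) :
    velocity a b h (fun s => f s + g s) t = velocity a b h f t + velocity a b h g t := by
  simp only [velocity, a.retarded_add hf hg,
    b.retarded_add (f := fun s => f (-s)) (g := fun s => g (-s)) (by fun_prop) (by fun_prop)]
  abel

lemma velocity_smul (c : ℂ) (f : ℝ → E) (t : ℝ) :
    velocity a b h (fun s => c • f s) t = c • velocity a b h f t := by
  simp only [velocity, a.retarded_smul, b.retarded_smul, smul_add, smul_sub]

lemma integralMap_add (hf : Continuous f) (hg : Continuous g) (t : ℝ) :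
    integralMap a b h (fun s => f s + g s) t
      = integralMap a b h f t + integralMap a b h g t := by
  have hf' : Continuous fun s => f (-s) := by fun_prop
  have hg' : Continuous fun s => g (-s) := by fun_prop
  simp only [integralMap, a.retarded_add hf hg, b.retarded_add hf' hg']
  rw [intervalIntegral.integral_add ((a.continuous_retarded hf).intervalIntegrable _ _)
      ((a.continuous_retarded hg).intervalIntegrable _ _),
    intervalIntegral.integral_add ((b.continuous_retarded hf').intervalIntegrable _ _)
      ((b.continuous_retarded hg').intervalIntegrable _ _)]
  abel

lemma integralMap_smul (c : ℂ) (f : ℝ → E) (t : ℝ) :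
    integralMap a b h (fun s => c • f s) t = c • integralMap a b h f t := by
  simp only [integralMap, a.retarded_smul, b.retarded_smul, smul_add,
    intervalIntegral.integral_smul]

/-- `velocity` as an endomorphism of the space of continuous functions on `[-h, h]`. -/
noncomputable def velocityOp (hh : 0 ≤ h) :
    Module.End ℂ (Icc (-h) h →ᵇ E) where
  toFun f := restrictBCF h (velocity a b h (extend hh f))
    (continuous_velocity a b (continuous_extend hh f))
  map_add' f g := by
    ext t
    exact velocity_add a b (continuous_extend hh f) (continuous_extend hh g) t
  map_smul' c f := by
    ext t
    exact velocity_smul a b c (extend hh f) t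

/-- `integralMap` as an endomorphism of the space of continuous functions on `[-h, h]`. -/
noncomputable def integralOp (hh : 0 ≤ h) :
    Module.End ℂ (Icc (-h) h →ᵇ E) where
  toFun f := restrictBCF h (integralMap a b h (extend hh f))
    (continuous_integralMap a b (continuous_extend hh f))
  map_add' f g := by
    ext t
    exact integralMap_add a b (continuous_extend hh f) (continuous_extend hh g) t
  map_smul' c f := by
    ext t
    exact integralMap_smul a b c (extend hh f) t

lemma integralOp_add_const_eq_iff (hh : 0 ≤ h) (f : Icc (-h) h →ᵇ E) :
    f = integralOp a b hh f + BoundedContinuousFunction.const _ q ↔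
      IsTwoSidedSolution a b h q (extend hh f) := by
  rw [isTwoSidedSolution_iff_integralMap hh]
  constructor
  · intro hf t ht
    rw [extend_of_mem hh f ht]
    exact DFunLike.congr_fun hf ⟨t, ht⟩
  · intro hf
    ext t
    rw [← extend_of_mem hh f t.2, hf t t.2]
    rfl

lemma integralOp_eq_self_iff (hh : 0 ≤ h) (f : Icc (-h) h →ᵇ E) :
    integralOp a b hh f = f ↔ IsTwoSidedSolution a b h 0 (extend hh f) := by
  rw [← integralOp_add_const_eq_iff, eq_comm]
  have : BoundedContinuousFunction.const (Icc (-h) h) (0 : E) = 0 := rfl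
  rw [this, add_zero]

lemma norm_integral_max_sub_le {F : ℝ → E} (hF : Continuous F) {C : ℝ} (hC0 : 0 ≤ C)
    (hC : ∀ t, ‖F t‖ ≤ C) (x y : ℝ) :
    ‖(∫ s in (0 : ℝ)..max x 0, F s) - ∫ s in (0 : ℝ)..max y 0, F s‖ ≤ C * |x - y| := by
  rw [intervalIntegral.integral_interval_sub_left (hF.intervalIntegrable _ _)
    (hF.intervalIntegrable _ _)]
  exact (intervalIntegral.norm_integral_le_of_norm_le_const fun t _ => hC t).trans
    (mul_le_mul_of_nonneg_left (abs_max_sub_max_le_abs x y 0) hC0)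

/-- The image of the unit ball is bounded and equi-Lipschitz, so Arzelà–Ascoli applies. -/
theorem isCompactOperator_integralOp [FiniteDimensional ℂ E] (hh : 0 ≤ h) :
    IsCompactOperator (integralOp a b hh) := by
  have : ProperSpace E := FiniteDimensional.proper ℂ E
  obtain ⟨A, hA0, hA⟩ := a.exists_norm_retarded_le hh
  obtain ⟨B, hB0, hB⟩ := b.exists_norm_retarded_le hh
  have bd : ∀ f ∈ Metric.closedBall (0 : Icc (-h) h →ᵇ E) 1, ∀ x y,
      ‖integralMap a b h (extend hh f) x - integralMap a b h (extend hh f) y‖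
        ≤ (A + B) * |x - y| ∧ ‖integralMap a b h (extend hh f) 0‖ ≤ 1 + (A + B) := by
    intro f hf x y
    rw [mem_closedBall_zero_iff] at hf
    have hfc := continuous_extend hh f
    have h1 : ∀ t, ‖a.retarded h (extend hh f) t‖ ≤ A :=
      hA _ fun t => (norm_extend_le hh f t).trans hf
    have h2 : ∀ t, ‖b.retarded h (fun s => extend hh f (-s)) t‖ ≤ B :=
      hB _ fun t => (norm_extend_le hh f _).trans hf
    constructor
    · have e1 := norm_integral_max_sub_le (a.continuous_retarded (h := h) hfc) hA0 h1 x y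
      have e2 := norm_integral_max_sub_le
        (b.continuous_retarded (h := h) (f := fun s => extend hh f (-s)) (by fun_prop))
        hB0 h2 (-x) (-y)
      rw [neg_sub_neg, abs_sub_comm y x] at e2
      unfold integralMap
      rw [add_mul, add_assoc _ (∫ _ in _.._, _), add_assoc _ (∫ _ in _.._, _),
        add_sub_add_left_eq_sub, add_sub_add_comm]
      exact norm_add_le_of_le e1 e2
    · simp only [integralMap, neg_zero, max_self, intervalIntegral.integral_same, add_zero]
      exact norm_add_le_of_le ((norm_extend_le hh f _).trans hf) (norm_add_le_of_le (h1 0) (h2 0))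
  refine (isCompactOperator_iff_exists_mem_nhds_isCompact_closure_image _).2
    ⟨Metric.closedBall 0 1, Metric.closedBall_mem_nhds _ one_pos, ?_⟩
  refine BoundedContinuousFunction.arzela_ascoli
    (Metric.closedBall 0 (1 + (A + B) + (A + B) * h)) (isCompact_closedBall _ _) _ ?_ ?_
  · rintro _ x ⟨f, hf, rfl⟩
    rw [mem_closedBall_zero_iff]
    obtain ⟨e1, e2⟩ := bd f hf x 0
    have e3 : |(x : ℝ) - 0| ≤ h := by rw [sub_zero]; exact abs_le.2 x.2
    have := norm_add_le_of_le e2 (e1.trans (mul_le_mul_of_nonneg_left e3 (by positivity)))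
    rwa [add_sub_cancel] at this
  · refine (LipschitzWith.uniformEquicontinuous _ (A + B).toNNReal ?_).equicontinuous
    rintro ⟨_, f, hf, rfl⟩
    refine LipschitzWith.of_dist_le_mul fun x y => ?_
    rw [Real.coe_toNNReal _ (by positivity), dist_eq_norm, Subtype.dist_eq, Real.dist_eq]
    exact (bd f hf x y).1

variable {a b}

/-- The Fredholm alternative: uniqueness for `q = 0` gives existence for every `q`. -/
theorem exists_isTwoSidedSolution [FiniteDimensional ℂ E] (hh : 0 ≤ h)
    (hu : ∀ f : ℝ → E, Continuous f → IsTwoSidedSolution a b h 0 f → EqOn f 0 (Icc (-h) h))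
    (q : E) : ∃ f : ℝ → E, Continuous f ∧ IsTwoSidedSolution a b h q f := by
  have : CompleteSpace E := FiniteDimensional.complete ℂ E
  have hT := isCompactOperator_integralOp a b hh
  set T : (Icc (-h) h →ᵇ E) →L[ℂ] (Icc (-h) h →ᵇ E) :=
    ContinuousLinearMap.mkOfIsCompactOperator hT with hTdef
  have hTapp : ∀ f, T f = integralOp a b hh f := fun _ => rfl
  rcases IsCompactOperator.hasEigenvalue_or_mem_resolventSet (T := T) (μ := 1) hT one_ne_zero
    with he | hr
  · obtain ⟨f, hf⟩ := he.exists_hasEigenvector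
    have h1 : integralOp a b hh f = f := hf.apply_eq_smul.trans (one_smul _ _)
    refine absurd ?_ hf.2
    ext t
    rw [← extend_of_mem hh f t.2]
    exact hu _ (continuous_extend hh f) ((integralOp_eq_self_iff a b hh f).1 h1) t.2
  · rw [spectrum.mem_resolventSet_iff, ContinuousLinearMap.isUnit_iff_bijective] at hr
    obtain ⟨f, hf⟩ := hr.2 (BoundedContinuousFunction.const _ q)
    refine ⟨extend hh f, continuous_extend hh f, (integralOp_add_const_eq_iff a b hh f).1 ?_⟩
    rw [← hf, ← hTapp]
    simp

/-- A nonzero homogeneous solution yields an exponential one: the homogeneous solutions form a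
finite-dimensional space that is stable under differentiation. -/
theorem IsTwoSidedSolution.exists_exp_solution [FiniteDimensional ℂ E] (hh : 0 ≤ h)
    (hab : ∀ A ∈ a.coeffs, ∀ B ∈ b.coeffs, Commute A B)
    (hfc : Continuous f) (hf : IsTwoSidedSolution a b h 0 f) (hf0 : ∃ t ∈ Icc (-h) h, f t ≠ 0) :
    ∃ (l : ℂ) (N : E), N ≠ 0 ∧ a.retarded h (fun s => Complex.exp (l * s) • N) 0 = l • N ∧
      b.retarded h (fun s => Complex.exp (-l * s) • N) 0 = -l • N := by
  have : CompleteSpace E := FiniteDimensional.complete ℂ E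
  have hT := isCompactOperator_integralOp a b hh
  let V : Submodule ℂ (Icc (-h) h →ᵇ E) := LinearMap.ker (integralOp a b hh - 1)
  have hV : ∀ f, f ∈ V ↔ integralOp a b hh f = f := fun f => by
    simp [V, sub_eq_zero]
  have hVc : IsClosed (V : Set (Icc (-h) h →ᵇ E)) := by
    have : (V : Set (Icc (-h) h →ᵇ E)) = {f | integralOp a b hh f = f} := Set.ext hV
    rw [this]
    exact isClosed_eq (ContinuousLinearMap.mkOfIsCompactOperator hT).continuous continuous_id
  have hVfin : FiniteDimensional ℂ V := by
    refine FiniteDimensional.of_isCompactOperator_id ?_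
    have := hT.restrict (V := V) (fun f hf => by rwa [(hV f).1 hf]) hVc
    rwa [show ⇑((integralOp a b hh).restrict _) = (id : V → V) from
      funext fun f => Subtype.ext ((hV f).1 f.2)] at this
  have hVinv : ∀ f ∈ V, velocityOp a b hh f ∈ V := by
    intro f hf
    have hs := (integralOp_eq_self_iff a b hh f).1 ((hV f).1 hf)
    have hvc := continuous_velocity a b (h := h) (continuous_extend hh f)
    refine (hV _).2 ((integralOp_eq_self_iff a b hh _).2 ?_)
    refine (hs.derivative hh hab (continuous_extend hh f) hvc
      (fun t ht => velocity_of_nonneg a b ht.1) (fun t ht => hs.velocity_neg ht.1)).congr hh ?_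
    exact fun t ht => (extend_of_mem hh (velocityOp a b hh f) ht).symm
  have hVne : Nontrivial V := by
    obtain ⟨t, ht, hne⟩ := hf0
    have hs : EqOn f (extend hh (restrictBCF h f hfc)) (Icc (-h) h) :=
      fun t ht => (extend_of_mem hh (restrictBCF h f hfc) ht).symm
    refine ⟨⟨restrictBCF h f hfc, (hV _).2 ((integralOp_eq_self_iff a b hh _).2
      (hf.congr hh hs))⟩, 0, fun h0 => hne ?_⟩
    exact DFunLike.congr_fun (congrArg Subtype.val h0) ⟨t, ht⟩
  obtain ⟨l, hl⟩ := Module.End.exists_eigenvalue ((velocityOp a b hh).restrict hVinv)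
  obtain ⟨⟨w, hwV⟩, hw⟩ := hl.exists_hasEigenvector
  have hws := (integralOp_eq_self_iff a b hh w).1 ((hV w).1 hwV)
  have hwl : ∀ t ∈ Icc (-h) h, velocity a b h (extend hh w) t = l • extend hh w t := by
    intro t ht
    rw [extend_of_mem hh w ht]
    exact DFunLike.congr_fun (congrArg Subtype.val hw.apply_eq_smul) ⟨t, ht⟩
  refine ⟨l, extend hh w 0, hws.eigenvector hh (continuous_extend hh w) (fun t ht => ?_)
    (fun t ht => ?_) ?_⟩
  · rw [← hwl t ⟨by linarith [ht.1], ht.2⟩, velocity_of_nonneg a b ht.1]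
  · rw [← hwl (-t) ⟨by linarith [ht.2], by linarith [ht.1]⟩, hws.velocity_neg ht.1]
  · by_contra! hc
    refine hw.2 (Subtype.ext ?_)
    ext t
    rw [← extend_of_mem hh w t.2]
    exact hc t t.2

end DelayKernel

/-! ### Kernels conjugate under an involution -/

namespace DelayKernel

variable {E : Type*} [NormedAddCommGroup E] [NormedSpace ℂ E]
  {a b : DelayKernel E} {h : ℝ} {f g : ℝ → E} {p q : E}

lemma IsTwoSidedSolution.add (hf : IsTwoSidedSolution a b h p f)
    (hg : IsTwoSidedSolution a b h q g) (hfc : Continuous f) (hgc : Continuous g) :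
    IsTwoSidedSolution a b h (p + q) fun t => f t + g t := by
  have hf' : Continuous fun s => f (-s) := by fun_prop
  have hg' : Continuous fun s => g (-s) := by fun_prop
  refine ⟨?_, fun t ht => ?_, fun t ht => ?_⟩
  · rw [a.retarded_add hfc hgc, b.retarded_add hf' hg', add_add_add_comm, hf.jump, hg.jump,
      neg_add]
  · simp only [a.retarded_add hfc hgc]
    rw [intervalIntegral.integral_add ((a.continuous_retarded hfc).intervalIntegrable _ _)
      ((a.continuous_retarded hgc).intervalIntegrable _ _), hf.forward t ht, hg.forward t ht]
    abel
  · simp only [b.retarded_add hf' hg']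
    rw [intervalIntegral.integral_add ((b.continuous_retarded hf').intervalIntegrable _ _)
      ((b.continuous_retarded hg').intervalIntegrable _ _), hf.backward t ht, hg.backward t ht]
    abel

lemma IsTwoSidedSolution.smul (c : ℂ) (hf : IsTwoSidedSolution a b h q f) :
    IsTwoSidedSolution a b h (c • q) fun t => c • f t := by
  refine ⟨?_, fun t ht => ?_, fun t ht => ?_⟩
  · rw [a.retarded_smul, b.retarded_smul, ← smul_add, hf.jump, smul_neg]
  · simp only [a.retarded_smul]
    rw [intervalIntegral.integral_smul, ← smul_add, ← hf.forward t ht]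
  · simp only [b.retarded_smul]
    rw [intervalIntegral.integral_smul, ← smul_add, ← hf.backward t ht]

lemma IsTwoSidedSolution.sub (hf : IsTwoSidedSolution a b h q f)
    (hg : IsTwoSidedSolution a b h q g) (hfc : Continuous f) (hgc : Continuous g) :
    IsTwoSidedSolution a b h 0 fun t => f t - g t := by
  simpa [sub_eq_add_neg] using hf.add (hg.smul (-1)) hfc (hgc.const_smul _)

/-- The kernel with coefficients `σ a σ`. -/
noncomputable def conj (a : DelayKernel E) (σ : E →L[ℂ] E) : DelayKernel E where
  present := σ ∘L a.present ∘L σ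
  delayed := σ ∘L a.delayed ∘L σ
  density θ := σ ∘L a.density θ ∘L σ
  continuous_density :=
    continuous_const.clm_comp (a.continuous_density.clm_comp continuous_const)

variable [CompleteSpace E] {σ : E →L[ℂ] E}

lemma retarded_conj (hf : Continuous f) (t : ℝ) :
    (a.conj σ).retarded h f t = σ (a.retarded h (fun s => σ (f s)) t) := by
  have := ContinuousLinearMap.intervalIntegral_comp_comm σ
    (a.intervalIntegrable_density (f := fun s => σ (f s)) (by fun_prop) t (-h) 0)
  simp only [retarded, map_add, ← this]
  rfl

/-- If `b` is conjugate to `a` under an involution `σ`, the two-sided problem is invariant under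
`f(t) ↦ σ f(-t)`. -/
lemma IsTwoSidedSolution.reflect (hσ : ∀ x, σ (σ x) = x)
    (hf : IsTwoSidedSolution a (a.conj σ) h q f) (hfc : Continuous f) :
    IsTwoSidedSolution a (a.conj σ) h (σ q) fun t => σ (f (-t)) := by
  have hf' : Continuous fun s => f (-s) := by fun_prop
  have hσf' : Continuous fun s => σ (f (-s)) := by fun_prop
  have e1 : ∀ t, a.retarded h (fun s => σ (f (-s))) t
      = σ ((a.conj σ).retarded h (fun s => f (-s)) t) := fun t => by
    rw [retarded_conj hf', hσ]
  have e2 : ∀ t, (a.conj σ).retarded h (fun s => σ (f s)) t = σ (a.retarded h f t) :=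
    fun t => by
      rw [retarded_conj (by fun_prop)]
      simp only [hσ]
  refine ⟨?_, fun t ht => ?_, fun t ht => ?_⟩
  · simp only [neg_neg]
    rw [e1, e2, ← map_add, add_comm, hf.jump, map_neg]
  · simp only [e1, neg_zero]
    rw [ContinuousLinearMap.intervalIntegral_comp_comm _
      ((continuous_retarded _ hf').intervalIntegrable _ _), hf.backward t ht, map_add]
  · simp only [neg_zero, neg_neg, e2]
    rw [ContinuousLinearMap.intervalIntegral_comp_comm _
      ((continuous_retarded _ hfc).intervalIntegrable _ _), hf.forward t ht, map_add]

lemma IsTwoSidedSolution.average_reflect (hσ : ∀ x, σ (σ x) = x) (hq : σ q = q)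
    (hf : IsTwoSidedSolution a (a.conj σ) h q f) (hfc : Continuous f) :
    IsTwoSidedSolution a (a.conj σ) h q fun t => (1 / 2 : ℂ) • (f t + σ (f (-t))) := by
  have := (hf.add (hf.reflect hσ hfc) hfc (by fun_prop)).smul (1 / 2)
  rwa [hq, ← two_smul ℂ, smul_smul, one_div_mul_cancel two_ne_zero, one_smul] at this

lemma retarded_conj_neg_of_symmetric (hσ : ∀ x, σ (σ x) = x) (hfc : Continuous f)
    (hs : ∀ t ∈ Icc 0 h, f (-t) = σ (f t)) {t : ℝ} (ht : t ∈ Icc 0 h) :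
    (a.conj σ).retarded h (fun s => f (-s)) t = σ (a.retarded h f t) := by
  rw [retarded_conj (by fun_prop)]
  refine congrArg σ (a.retarded_congr (ht.1.trans ht.2) fun x hx => ?_)
  rcases le_total 0 x with h0 | h0
  · rw [hs x ⟨h0, hx.2.trans ht.2⟩, hσ]
  · have := hs (-x) ⟨by linarith, by linarith [hx.1, ht.1]⟩
    rw [neg_neg] at this
    exact this.symm

/-- For functions with `f(-t) = σ f(t)` the backward equation follows from the forward one. -/
lemma isTwoSidedSolution_of_symmetric (hh : 0 ≤ h) (hσ : ∀ x, σ (σ x) = x) (hfc : Continuous f)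
    (hs : ∀ t ∈ Icc 0 h, f (-t) = σ (f t))
    (hj : a.retarded h f 0 + σ (a.retarded h f 0) = -q)
    (hf : ∀ t ∈ Icc 0 h, f t = f 0 + ∫ s in (0 : ℝ)..t, a.retarded h f s) :
    IsTwoSidedSolution a (a.conj σ) h q f := by
  have e : ∀ t ∈ Icc 0 h, (a.conj σ).retarded h (fun s => f (-s)) t = σ (a.retarded h f t) :=
    fun t ht => retarded_conj_neg_of_symmetric hσ hfc hs ht
  have h00 : (0 : ℝ) ∈ Icc 0 h := ⟨le_rfl, hh⟩
  refine ⟨by rw [e 0 h00, hj], hf, fun t ht => ?_⟩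
  have e' : ∫ s in (0 : ℝ)..t, (a.conj σ).retarded h (fun s => f (-s)) s
      = ∫ s in (0 : ℝ)..t, σ (a.retarded h f s) :=
    intervalIntegral.integral_congr fun s hs => by
      rw [uIcc_of_le ht.1] at hs
      exact e s ⟨hs.1, hs.2.trans ht.2⟩
  have h0 := hs 0 h00
  rw [neg_zero] at h0
  rw [e', ContinuousLinearMap.intervalIntegral_comp_comm _
      ((continuous_retarded _ hfc).intervalIntegrable _ _), hs t ht, hf t ht, map_add, ← h0]

end DelayKernel

lemma DelaySystem.continuous_AD {n m : ℕ} (S : DelaySystem n m) : Continuous S.AD := by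
  have h : Continuous fun θ : ℝ => NormedSpace.exp (θ • S.Ad) := by
    let _ : NormedRing (Matrix (Fin m) (Fin m) ℝ) := Matrix.linftyOpNormedRing
    let _ : NormedAlgebra ℝ (Matrix (Fin m) (Fin m) ℝ) := Matrix.linftyOpNormedAlgebra
    let _ : NormedAlgebra ℚ (Matrix (Fin m) (Fin m) ℝ) := NormedAlgebra.restrictScalars ℚ ℝ _
    have : CompleteSpace (Matrix (Fin m) (Fin m) ℝ) := FiniteDimensional.complete ℝ _
    exact NormedSpace.exp_continuous.comp (by fun_prop)
  exact (continuous_const.matrix_mul h).matrix_mul continuous_const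

/-! ### The matrix kernel of a time-delay system -/

section Matrix

attribute [local instance] Matrix.normedAddCommGroup

/-- Only the complex normed space structure on complex matrices is made an instance. The real one is
then obtained from it by restriction of scalars, as for the abstract space `E` above. -/
@[reducible] noncomputable def matrixNormedSpace (n : ℕ) :
    NormedSpace ℂ (Matrix (Fin n) (Fin n) ℂ) := Matrix.normedSpace

attribute [local instance] matrixNormedSpace

variable {n m : ℕ}

/-- The Bochner integral of a continuous matrix-valued function is computed entrywise. -/
lemma integral_apply {F : ℝ → Matrix (Fin n) (Fin n) ℂ} (hF : Continuous F) (x y : ℝ)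
    (i j : Fin n) : (∫ s in x..y, F s) i j = ∫ s in x..y, F s i j :=
  ((LinearMap.toContinuousLinearMap (Matrix.entryLinearMap ℂ ℂ i j)).intervalIntegral_comp_comm
    (hF.intervalIntegrable x y)).symm

lemma integral_eq_matrixIntegral {F : ℝ → Matrix (Fin n) (Fin n) ℂ} (hF : Continuous F)
    (x y : ℝ) : (∫ s in x..y, F s) = matrixIntegral x y F := by
  ext i j
  exact integral_apply hF x y i j

/-- Transposition as a continuous linear map. -/
noncomputable def transposeCLM (n : ℕ) :
    Matrix (Fin n) (Fin n) ℂ →L[ℂ] Matrix (Fin n) (Fin n) ℂ :=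
  LinearMap.toContinuousLinearMap (Matrix.transposeLinearEquiv (Fin n) (Fin n) ℂ ℂ).toLinearMap

/-- Right multiplication `N ↦ N A`, as a linear function of `A`. -/
noncomputable def mulRightCLM (n : ℕ) : Matrix (Fin n) (Fin n) ℂ →ₗ[ℂ]
    Matrix (Fin n) (Fin n) ℂ →L[ℂ] Matrix (Fin n) (Fin n) ℂ :=
  LinearMap.toContinuousLinearMap.toLinearMap ∘ₗ (LinearMap.mul ℂ (Matrix (Fin n) (Fin n) ℂ)).flip

namespace DelaySystem

variable (S : DelaySystem n m)

/-- The kernel of right multiplications by `A₀`, `A₁`, `A_D(θ)` on complex matrices. Its conjugate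
under transposition consists of the left multiplications by the transposes. -/
noncomputable def kernel : DelayKernel (Matrix (Fin n) (Fin n) ℂ) where
  present := mulRightCLM n (S.A₀.map Complex.ofReal)
  delayed := mulRightCLM n (S.A₁.map Complex.ofReal)
  density θ := mulRightCLM n ((S.AD θ).map Complex.ofReal)
  continuous_density := (LinearMap.continuous_of_finiteDimensional (mulRightCLM n)).comp
    (S.continuous_AD.matrix_map Complex.continuous_ofReal)

lemma commute_kernel : ∀ A ∈ S.kernel.coeffs, ∀ B ∈ (S.kernel.conj (transposeCLM n)).coeffs,
    Commute A B := by
  have h1 : ∀ A ∈ S.kernel.coeffs, ∃ X, A = mulRightCLM n X := by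
    rintro A ((rfl | rfl) | ⟨θ, rfl⟩)
    exacts [⟨_, rfl⟩, ⟨_, rfl⟩, ⟨_, rfl⟩]
  have h2 : ∀ B ∈ (S.kernel.conj (transposeCLM n)).coeffs,
      ∃ Y, B = transposeCLM n ∘L mulRightCLM n Y ∘L transposeCLM n := by
    rintro A ((rfl | rfl) | ⟨θ, rfl⟩)
    exacts [⟨_, rfl⟩, ⟨_, rfl⟩, ⟨_, rfl⟩]
  intro A hA B hB
  obtain ⟨X, rfl⟩ := h1 A hA
  obtain ⟨Y, rfl⟩ := h2 B hB
  ext N : 1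
  change (N.transpose * Y).transpose * X = ((N * X).transpose * Y).transpose
  simp [Matrix.transpose_mul, Matrix.mul_assoc]

lemma kernel_retarded {f : ℝ → Matrix (Fin n) (Fin n) ℂ} (hf : Continuous f) (t : ℝ) :
    S.kernel.retarded S.h f t = f t * S.A₀.map Complex.ofReal
      + f (t - S.h) * S.A₁.map Complex.ofReal
      + matrixIntegral (-S.h) 0 fun θ => f (t + θ) * (S.AD θ).map Complex.ofReal := by
  have hc : Continuous fun θ => f (t + θ) * (S.AD θ).map Complex.ofReal :=
    (hf.comp (continuous_const.add continuous_id)).matrix_mul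
      (S.continuous_AD.matrix_map Complex.continuous_ofReal)
  rw [← integral_eq_matrixIntegral hc]
  rfl

/-- The right-hand side of the dynamic part of the delay Lyapunov equation. -/
noncomputable def rhs (P : ℝ → Matrix (Fin n) (Fin n) ℝ) (t : ℝ) : Matrix (Fin n) (Fin n) ℝ :=
  P t * S.A₀ + P (t - S.h) * S.A₁ + matrixIntegral (-S.h) 0 fun θ => P (t + θ) * S.AD θ

lemma kernel_retarded_ofReal {P : ℝ → Matrix (Fin n) (Fin n) ℝ} (hP : Continuous P) (t : ℝ) :
    S.kernel.retarded S.h (fun s => (P s).map Complex.ofReal) t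
      = (S.rhs P t).map Complex.ofReal := by
  rw [kernel_retarded _ (hP.matrix_map Complex.continuous_ofReal)]
  ext i j
  simp only [rhs, matrixIntegral, Matrix.add_apply, Matrix.mul_apply, Matrix.map_apply,
    Matrix.of_apply]
  push_cast
  rw [← intervalIntegral.integral_ofReal]
  push_cast
  rfl

lemma kernel_retarded_re {f : ℝ → Matrix (Fin n) (Fin n) ℂ} (hf : Continuous f) (t : ℝ) :
    (S.kernel.retarded S.h f t).map Complex.re = S.rhs (fun s => (f s).map Complex.re) t := by
  rw [kernel_retarded _ hf]
  ext i j
  have hc : Continuous fun θ => (f (t + θ) * (S.AD θ).map Complex.ofReal) i j :=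
    ((hf.comp (continuous_const.add continuous_id)).matrix_mul
      (S.continuous_AD.matrix_map Complex.continuous_ofReal)).matrix_elem i j
  have := Complex.reCLM.intervalIntegral_comp_comm (hc.intervalIntegrable (μ := volume) (-S.h) 0)
  simp only [Complex.reCLM_apply] at this
  simp only [rhs, matrixIntegral, Matrix.add_apply, Matrix.map_apply, Matrix.of_apply,
    Complex.add_re, ← this]
  simp [Matrix.mul_apply]

/-- The exponential `e^{ls} N` solves `f' = L f` if and only if `N Δ(l) = 0`. -/
lemma kernel_retarded_exp (l : ℂ) (N : Matrix (Fin n) (Fin n) ℂ) :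
    S.kernel.retarded S.h (fun s => Complex.exp (l * s) • N) 0 = l • N - N * S.charMatrix l := by
  have hc : Continuous fun θ : ℝ => Complex.exp (l * θ) • (S.AD θ).map Complex.ofReal :=
    Continuous.smul (f := fun θ : ℝ => Complex.exp (l * θ)) (by fun_prop) (S.continuous_AD.matrix_map Complex.continuous_ofReal)
  have : ∫ θ in (-S.h)..0, N * (Complex.exp (l * θ) • (S.AD θ).map Complex.ofReal)
      = N * ∫ θ in (-S.h)..0, Complex.exp (l * θ) • (S.AD θ).map Complex.ofReal :=
    ContinuousLinearMap.intervalIntegral_comp_comm (LinearMap.toContinuousLinearMap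
      (LinearMap.mul ℂ (Matrix (Fin n) (Fin n) ℂ) N)) (hc.intervalIntegrable _ _)
  have e : S.kernel.retarded S.h (fun s => Complex.exp (l * s) • N) 0
      = Complex.exp (l * (0 : ℝ)) • N * S.A₀.map Complex.ofReal
        + Complex.exp (l * (0 - S.h : ℝ)) • N * S.A₁.map Complex.ofReal
        + ∫ θ in (-S.h)..0, Complex.exp (l * (0 + θ : ℝ)) • N * (S.AD θ).map Complex.ofReal := rfl
  rw [e, charMatrix, ← integral_eq_matrixIntegral hc]
  simp only [Matrix.mul_sub, ← this]
  simp
  abel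

end DelaySystem
end Matrix

/-! ### The delay Lyapunov equation as a two-sided problem -/

section Matrix

attribute [local instance] Matrix.normedAddCommGroup matrixNormedSpace

variable {n m : ℕ}

namespace DelaySystem

variable (S : DelaySystem n m) {Q : Matrix (Fin n) (Fin n) ℝ} {P : ℝ → Matrix (Fin n) (Fin n) ℝ}

/-- The complexified delay Lyapunov equation with right-hand side `q`, without the requirement
`f(-t) = f(t)ᵀ`. -/
def LiftSolution (q : Matrix (Fin n) (Fin n) ℂ) (f : ℝ → Matrix (Fin n) (Fin n) ℂ) : Prop :=
  DelayKernel.IsTwoSidedSolution S.kernel (S.kernel.conj (transposeCLM n)) S.h q f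

lemma rhs_congr {P₁ P₂ : ℝ → Matrix (Fin n) (Fin n) ℝ} (h : EqOn P₁ P₂ (Icc (-S.h) S.h))
    {t : ℝ} (ht : t ∈ Icc 0 S.h) : S.rhs P₁ t = S.rhs P₂ t := by
  have hh := S.h_nonneg
  unfold rhs matrixIntegral
  rw [h ⟨by linarith [ht.1], ht.2⟩, h ⟨by linarith [ht.1], by linarith [ht.2]⟩]
  congr 2
  ext i j
  refine intervalIntegral.integral_congr fun θ hθ => ?_
  rw [uIcc_of_le (by linarith)] at hθ
  simp only
  rw [h ⟨by linarith [ht.1, hθ.1], by linarith [ht.2, hθ.2]⟩]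

/-- For symmetric `P` the algebraic part of the delay Lyapunov equation is the jump condition at
`0`. -/
lemma neg_eq_algebraic_iff (hP : ContinuousOn P (Icc (-S.h) S.h))
    (hs : ∀ t ∈ Icc 0 S.h, P (-t) = (P t).transpose) :
    (-Q = S.A₀.transpose * P 0 + P 0 * S.A₀ + S.A₁.transpose * P S.h + P (-S.h) * S.A₁
      + matrixIntegral (-S.h) 0 fun θ => (S.AD θ).transpose * P (-θ) + P θ * S.AD θ) ↔
    S.rhs P 0 + (S.rhs P 0).transpose = -Q := by
  have hh := S.h_nonneg
  have h0 : (P 0).transpose = P 0 := by simpa using (hs 0 ⟨le_rfl, hh⟩).symm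
  have hh' : (P (-S.h)).transpose = P S.h := by rw [hs _ ⟨hh, le_rfl⟩, Matrix.transpose_transpose]
  have hAD := S.continuous_AD
  have hu : uIcc (-S.h) 0 ⊆ Icc (-S.h) S.h := by
    rw [uIcc_of_le (by linarith)]; exact Icc_subset_Icc le_rfl hh
  have i1 : ∀ i j, IntervalIntegrable (fun θ => (P θ * S.AD θ) i j) volume (-S.h) 0 := fun i j =>
    ContinuousOn.intervalIntegrable
      ((continuous_id.matrix_elem i j).comp_continuousOn
        (continuousOn_iff_continuous_domRestrict.2
          ((continuousOn_iff_continuous_domRestrict.1 (hP.mono hu)).matrix_mul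
            (hAD.comp continuous_subtype_val))))
  have e : (matrixIntegral (-S.h) 0 fun θ => (S.AD θ).transpose * P (-θ) + P θ * S.AD θ)
      = (matrixIntegral (-S.h) 0 fun θ => P θ * S.AD θ).transpose
        + matrixIntegral (-S.h) 0 fun θ => P θ * S.AD θ := by
    ext i j
    simp only [matrixIntegral, Matrix.add_apply, Matrix.transpose_apply, Matrix.of_apply]
    rw [← intervalIntegral.integral_add (i1 j i) (i1 i j)]
    refine intervalIntegral.integral_congr fun θ hθ => ?_
    rw [uIcc_of_le (by linarith)] at hθ
    have := hs (-θ) ⟨by linarith [hθ.2], by linarith [hθ.1]⟩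
    rw [neg_neg] at this
    have e' : (S.AD θ).transpose * P (-θ) = (P θ * S.AD θ).transpose := by
      rw [Matrix.transpose_mul, this, Matrix.transpose_transpose]
    change ((S.AD θ).transpose * P (-θ)) i j + (P θ * S.AD θ) i j = _
    rw [e']
    rfl
  rw [e, eq_comm]
  simp only [rhs, zero_sub, zero_add, Matrix.transpose_add, Matrix.transpose_mul, h0, hh']
  constructor <;> intro h <;> rw [← h] <;> abel

variable {S}

lemma IsSolution.continuousOn (hP : S.IsSolution Q P) : ContinuousOn P (Icc (-S.h) S.h) := by
  have hh := S.h_nonneg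
  have h1 : ContinuousOn P (Icc 0 S.h) := fun t ht =>
    continuousWithinAt_pi.2 fun i => continuousWithinAt_pi.2 fun j =>
      (hasDerivWithinAt_pi.1 (hasDerivWithinAt_pi.1 (hP.dynamic t ht) i) j).continuousWithinAt
  have h2 : ContinuousOn P (Icc (-S.h) 0) := by
    have : ContinuousOn (fun t => (P (-t)).transpose) (Icc (-S.h) 0) :=
      (continuous_id.matrix_transpose).comp_continuousOn
        (h1.comp continuous_neg.continuousOn fun t ht => ⟨by linarith [ht.2], by linarith [ht.1]⟩)
    refine this.congr fun t ht => ?_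
    have := hP.symmetric (-t) ⟨by linarith [ht.2], by linarith [ht.1]⟩
    rwa [neg_neg] at this
  rw [← Icc_union_Icc_eq_Icc (by linarith : -S.h ≤ 0) hh]
  exact h2.union_of_isClosed h1 isClosed_Icc isClosed_Icc

/-- A solution of the delay Lyapunov equation, changed outside `[-h, h]` to be continuous on `ℝ`,
solves the complexified equation. -/
theorem IsSolution.exists_lift (hP : S.IsSolution Q P) :
    ∃ f : ℝ → Matrix (Fin n) (Fin n) ℂ, Continuous f ∧
      S.LiftSolution (Q.map Complex.ofReal) f ∧
      (∀ t ∈ Icc 0 S.h, f (-t) = (f t).transpose) ∧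
      ∀ t ∈ Icc (-S.h) S.h, f t = (P t).map Complex.ofReal := by
  have hh := S.h_nonneg
  have hPc := hP.continuousOn
  set P' : ℝ → Matrix (Fin n) (Fin n) ℝ :=
    IccExtend (neg_le_self hh) ((Icc (-S.h) S.h).domRestrict P) with hP'
  have hP'c : Continuous P' := (continuousOn_iff_continuous_domRestrict.1 hPc).Icc_extend'
  have hPP : EqOn P' P (Icc (-S.h) S.h) := fun t ht => by
    rw [hP', IccExtend_of_mem _ _ ht]; rfl
  have hsub : ∀ t ∈ Icc 0 S.h, t ∈ Icc (-S.h) S.h ∧ -t ∈ Icc (-S.h) S.h := fun t ht =>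
    ⟨⟨by linarith [ht.1], ht.2⟩, ⟨by linarith [ht.2], by linarith [ht.1]⟩⟩
  have hs : ∀ t ∈ Icc 0 S.h, P' (-t) = (P' t).transpose := fun t ht => by
    rw [hPP (hsub t ht).1, hPP (hsub t ht).2, hP.symmetric t ht]
  have hfc := hP'c.matrix_map Complex.continuous_ofReal
  have hsf : ∀ t ∈ Icc 0 S.h, (P' (-t)).map Complex.ofReal
      = ((P' t).map Complex.ofReal).transpose := fun t ht => by rw [hs t ht]; rfl
  refine ⟨fun t => (P' t).map Complex.ofReal, hfc,
    DelayKernel.isTwoSidedSolution_of_symmetric hh (fun x => rfl) hfc hsf ?_ fun t ht => ?_,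
    hsf, fun t ht => congrArg (fun M => M.map Complex.ofReal) (hPP ht)⟩
  · rw [kernel_retarded_ofReal _ hP'c, S.rhs_congr hPP ⟨le_rfl, hh⟩]
    have := (S.neg_eq_algebraic_iff hPc hP.symmetric).1 hP.algebraic
    ext i j
    have := congrFun (congrFun this i) j
    simp only [Matrix.add_apply, Matrix.transpose_apply, Matrix.neg_apply] at this
    change (S.rhs P 0 i j : ℂ) + (S.rhs P 0 j i : ℂ) = -(Q i j : ℂ)
    exact_mod_cast congrArg Complex.ofReal this
  · ext i j
    have hrc := S.kernel.continuous_retarded (h := S.h) hfc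
    rw [Matrix.add_apply, integral_apply hrc]
    simp only [kernel_retarded_ofReal _ hP'c, Matrix.map_apply]
    have hrc' : Continuous fun s => S.rhs P' s i j := by
      have := (hrc.matrix_map Complex.continuous_re).matrix_elem i j
      simpa only [kernel_retarded_ofReal _ hP'c, Matrix.map_apply, Complex.ofReal_re] using this
    rw [intervalIntegral.integral_ofReal, ← Complex.ofReal_add]
    congr 1
    rw [intervalIntegral.integral_eq_sub_of_hasDerivAt_of_le (f := fun s => P' s i j) ht.1
      (hP'c.matrix_elem i j).continuousOn (fun s hs' => ?_) (hrc'.intervalIntegrable _ _)]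
    · ring
    · have hsI : s ∈ Icc 0 S.h := ⟨hs'.1.le, hs'.2.le.trans ht.2⟩
      have hd := hP.dynamic s hsI
      have hd2 : HasDerivWithinAt (fun s => P s i j) (S.rhs P s i j) (Icc 0 S.h) s :=
        hasDerivWithinAt_pi.1 (hasDerivWithinAt_pi.1 hd i) j
      rw [S.rhs_congr hPP hsI]
      refine (hd2.congr (fun x hx => by rw [hPP (hsub x hx).1])
        (by rw [hPP (hsub s hsI).1])).hasDerivAt (Icc_mem_nhds hs'.1 (hs'.2.trans_le ht.2))

/-- The real part of a symmetric solution of the complexified equation solves the delay Lyapunov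
equation. -/
theorem LiftSolution.isSolution_re {f : ℝ → Matrix (Fin n) (Fin n) ℂ} (hfc : Continuous f)
    (hf : S.LiftSolution (Q.map Complex.ofReal) f)
    (hs : ∀ t ∈ Icc 0 S.h, f (-t) = (f t).transpose) :
    S.IsSolution Q fun t => (f t).map Complex.re := by
  have hh := S.h_nonneg
  have hrc := S.kernel.continuous_retarded (h := S.h) hfc
  have hPc := hfc.matrix_map Complex.continuous_re
  have hs' : ∀ t ∈ Icc 0 S.h, (f (-t)).map Complex.re = ((f t).map Complex.re).transpose :=
    fun t ht => by rw [hs t ht]; rfl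
  refine ⟨fun t ht => ?_, hs', (S.neg_eq_algebraic_iff hPc.continuousOn hs').2 ?_⟩
  · refine hasDerivWithinAt_pi.2 fun i => hasDerivWithinAt_pi.2 fun j => ?_
    have hc := hrc.matrix_elem i j
    have h1 : HasDerivAt (fun t => f 0 i j + ∫ s in (0 : ℝ)..t, S.kernel.retarded S.h f s i j)
        (S.kernel.retarded S.h f t i j) t :=
      (intervalIntegral.integral_hasDerivAt_right (hc.intervalIntegrable _ _)
        (hc.stronglyMeasurableAtFilter _ _) hc.continuousAt).const_add _
    have h2 := (Complex.reCLM.hasFDerivAt.comp_hasDerivAt t h1).hasDerivWithinAt (s := Icc 0 S.h)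
    have h3 : S.rhs (fun t => (f t).map Complex.re) t i j
        = (S.kernel.retarded S.h f t i j).re := by
      rw [← kernel_retarded_re _ hfc]; rfl
    have h4 : ∀ x ∈ Icc 0 S.h, (f x).map Complex.re i j
        = (f 0 i j + ∫ s in (0 : ℝ)..x, S.kernel.retarded S.h f s i j).re := fun x hx => by
      rw [Matrix.map_apply, hf.forward x hx, Matrix.add_apply, integral_apply hrc]
    have h5 := h2.congr h4 (h4 t ht)
    rw [show Complex.reCLM (S.kernel.retarded S.h f t i j) = _ from h3.symm] at h5
    exact h5
  · have hσ : (S.kernel.conj (transposeCLM n)).retarded S.h (fun s => f (-s)) 0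
        = (S.kernel.retarded S.h f 0).transpose :=
      DelayKernel.retarded_conj_neg_of_symmetric (fun _ => rfl) hfc hs ⟨le_rfl, hh⟩
    have hj := hf.jump
    rw [hσ] at hj
    rw [← kernel_retarded_re _ hfc]
    ext i j
    simpa using congrArg Complex.re (congrFun (congrFun hj i) j)

end DelaySystem
end Matrix

/-! ### The spectrum condition -/

section Matrix

attribute [local instance] Matrix.normedAddCommGroup matrixNormedSpace

variable {n m : ℕ}

lemma det_eq_zero_of_mul_eq_zero {N M : Matrix (Fin n) (Fin n) ℂ} (hN : N ≠ 0) (h : N * M = 0) :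
    M.det = 0 := by
  by_contra hM
  exact hN ((Matrix.isUnit_iff_isUnit_det M).2 (isUnit_iff_ne_zero.2 hM) |>.mul_left_eq_zero.1 h)

namespace DelaySystem

variable {S : DelaySystem n m} {Q : Matrix (Fin n) (Fin n) ℝ}

/-- The mirror image of `kernel_retarded_exp`. -/
lemma kernel_conj_retarded_exp (l : ℂ) (N : Matrix (Fin n) (Fin n) ℂ) :
    (S.kernel.conj (transposeCLM n)).retarded S.h (fun s => Complex.exp (l * s) • N) 0
      = l • N - (S.charMatrix l).transpose * N := by
  have hc : Continuous fun s : ℝ => Complex.exp (l * s) • N := by fun_prop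
  refine (DelayKernel.retarded_conj hc 0).trans ?_
  refine (congrArg (transposeCLM n) (S.kernel_retarded_exp l N.transpose)).trans ?_
  change (l • N.transpose - N.transpose * S.charMatrix l).transpose = _
  simp [Matrix.transpose_mul]

theorem eqOn_zero_of_spectrumCondition (hS : S.SpectrumCondition)
    {f : ℝ → Matrix (Fin n) (Fin n) ℂ} (hfc : Continuous f) (hf : S.LiftSolution 0 f) :
    EqOn f 0 (Icc (-S.h) S.h) := by
  by_contra hne
  have hne' : ∃ t ∈ Icc (-S.h) S.h, f t ≠ 0 := by
    by_contra! hc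
    exact hne hc
  obtain ⟨l, N, hN, h1, h2⟩ :=
    DelayKernel.IsTwoSidedSolution.exists_exp_solution S.h_nonneg S.commute_kernel hfc hf hne'
  rw [kernel_retarded_exp, sub_eq_self] at h1
  rw [kernel_conj_retarded_exp, sub_eq_self] at h2
  refine hS l (det_eq_zero_of_mul_eq_zero hN h1) ?_
  refine det_eq_zero_of_mul_eq_zero (N := N.transpose)
    (fun h => hN (Matrix.transpose_eq_zero.1 h)) ?_
  simpa [Matrix.transpose_mul] using congrArg Matrix.transpose h2

theorem hasUniqueSolution_of_spectrumCondition (hQ : Q.IsSymm) (hS : S.SpectrumCondition) :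
    S.HasUniqueSolution Q := by
  refine ⟨?_, fun P₁ P₂ h₁ h₂ => ?_⟩
  · obtain ⟨f, hfc, hf⟩ := DelayKernel.exists_isTwoSidedSolution
      (a := S.kernel) (b := S.kernel.conj (transposeCLM n)) S.h_nonneg
      (fun f hfc hf => eqOn_zero_of_spectrumCondition hS hfc hf) (Q.map Complex.ofReal)
    have hm := hf.average_reflect (fun _ => rfl)
      (congrArg (fun M => M.map Complex.ofReal) hQ.eq) hfc
    have hc : Continuous fun t => (1 / 2 : ℂ) • (f t + (f (-t)).transpose) := by fun_prop
    refine ⟨_, LiftSolution.isSolution_re hc hm fun t _ => ?_⟩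
    rw [neg_neg, Matrix.transpose_smul, Matrix.transpose_add, Matrix.transpose_transpose, add_comm]
  · obtain ⟨f₁, hc₁, hf₁, -, he₁⟩ := h₁.exists_lift
    obtain ⟨f₂, hc₂, hf₂, -, he₂⟩ := h₂.exists_lift
    have hd := DelayKernel.IsTwoSidedSolution.sub hf₁ hf₂ hc₁ hc₂
    intro t ht
    have h0 := eqOn_zero_of_spectrumCondition hS (hc₁.sub hc₂) hd ht
    change f₁ t - f₂ t = 0 at h0
    rw [he₁ t ht, he₂ t ht] at h0
    ext i j
    have := congrFun (congrFun h0 i) j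
    exact Complex.ofReal_injective (sub_eq_zero.1 this)

theorem spectrumCondition_of_hasUniqueSolution (hU : S.HasUniqueSolution Q) :
    S.SpectrumCondition := by
  intro l hl hl'
  obtain ⟨⟨P, hP⟩, hu⟩ := hU
  obtain ⟨v, hv0, hv⟩ := Matrix.exists_vecMul_eq_zero_iff.2 hl
  obtain ⟨u, hu0, huM⟩ := Matrix.exists_vecMul_eq_zero_iff.2 hl'
  have key : ∀ (k : ℂ) (x y : Fin n → ℂ), Matrix.vecMul y (S.charMatrix k) = 0 →
      Matrix.vecMul x (S.charMatrix (-k)) = 0 →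
      S.LiftSolution 0 fun t => Complex.exp (k * t) • Matrix.vecMulVec x y := by
    intro k x y hy hx
    refine DelayKernel.isTwoSidedSolution_exp ?_ ?_
    · rw [kernel_retarded_exp, Matrix.vecMulVec_mul, hy, Matrix.vecMulVec_zero, sub_zero]
    · rw [kernel_conj_retarded_exp, Matrix.mul_vecMulVec, Matrix.mulVec_transpose, hx,
        Matrix.zero_vecMulVec, sub_zero]
  have h1 := key l u v hv huM
  have h2 := key (-l) v u huM (by rwa [neg_neg])
  have c1 : Continuous fun t : ℝ => Complex.exp (l * t) • Matrix.vecMulVec u v := by fun_prop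
  have c2 : Continuous fun t : ℝ => Complex.exp (-l * t) • Matrix.vecMulVec v u := by fun_prop
  have hG := DelayKernel.IsTwoSidedSolution.add h1 h2 c1 c2
  rw [add_zero] at hG
  obtain ⟨f, hfc, hf, hfs, hfP⟩ := hP.exists_lift
  have h0I : (0 : ℝ) ∈ Icc (-S.h) S.h := ⟨by linarith [S.h_nonneg], S.h_nonneg⟩
  -- `P` and `Re (f + c G)` are both solutions, where `G(0) = u vᵀ + v uᵀ`.
  have hre : ∀ c : ℂ, ∀ i j, (c * (u i * v j + v i * u j)).re = 0 := by
    intro c i j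
    have hs := DelayKernel.IsTwoSidedSolution.add hf (hG.smul c) hfc ((c1.add c2).const_smul c)
    rw [smul_zero, add_zero] at hs
    have hc : Continuous fun t : ℝ => f t + c • (Complex.exp (l * t) • Matrix.vecMulVec u v
        + Complex.exp (-l * t) • Matrix.vecMulVec v u) := by fun_prop
    have hsol := LiftSolution.isSolution_re hc hs fun t ht => by
      simp only [hfs t ht]
      ext i j
      simp [Matrix.vecMulVec_apply]
      ring
    have h1 : (P 0 i j + (c • (Complex.exp (l * (0 : ℝ)) • Matrix.vecMulVec u v
        + Complex.exp (-l * (0 : ℝ)) • Matrix.vecMulVec v u)) i j).re = P 0 i j := by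
      have := congrFun (congrFun (hu _ _ hsol hP h0I) i) j
      simp only [hfP 0 h0I] at this
      exact this
    simpa [Matrix.vecMulVec_apply] using h1
  -- The factors `1` and `-i` give the real and the imaginary part of `G(0)`.
  have hG0 : ∀ i j, u i * v j + v i * u j = 0 := fun i j => by
    refine Complex.ext (by simpa using hre 1 i j) ?_
    simpa using hre (-Complex.I) i j
  obtain ⟨i, hi⟩ := Function.ne_iff.1 hu0
  obtain ⟨j, hj⟩ := Function.ne_iff.1 hv0
  have hvi : v i = 0 := by
    have := hG0 i i
    rw [mul_comm (v i), ← two_mul, mul_eq_zero, mul_eq_zero] at this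
    rcases this with h | h | h
    exacts [absurd h two_ne_zero, absurd h hi, h]
  have := hG0 i j
  rw [hvi, zero_mul, add_zero] at this
  exact (mul_eq_zero.1 this).elim hi hj

end DelaySystem
end Matrix
end DelayLyapunov

theorem corollary1 {n m : ℕ} (S : DelayLyapunov.DelaySystem n m)
    (Q : Matrix (Fin n) (Fin n) ℝ) (hQ : Q.IsSymm) :
    S.HasUniqueSolution Q ↔ S.SpectrumCondition :=
  ⟨DelayLyapunov.DelaySystem.spectrumCondition_of_hasUniqueSolution,
    DelayLyapunov.DelaySystem.hasUniqueSolution_of_spectrumCondition hQ⟩
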